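/- Let $0<s<2$ and $C>0$, and let $B_s=(B_s(t))_{t\in\mathbb R}$ be a fractional Brownian motion on a probability space, i.e. a centered Gaussian process with $$\mathrm{Cov}(B_s(u),B_s(t))=C\big(|u|^s+|t|^s-|u-t|^s\big),\qquad u,t\in\mathbb R,$$ taken in a jointly measurable version (for instance one with continuous paths). For $u\ge 0$ define the $m$-times integrated fractional Brownian motion inductively by $B_s^{(-0)}(u)=B_s(u)$ and $B_s^{(-m)}(u)=\int_0^u B_s^{(-(m-1))}(t)\,dt$ for $m\ge 1$, the integrals being taken path by path. Then, for every integer $m\ge 0$: 1. almost surely, the path $t\mapsto B_s^{(-m)}(t)$ is integrable on $[0,u]$ for every $u\ge 0$ (so the process is well defined), and $(B_s^{(-m)}(u))_{u\ge 0}$ is a Gaussian process; 2. $B_s^{(-m)}$ has the non-degeneracy (ND) property on $(0,\infty)$: for every $k\ge 1$ and all times $0<t_1<\dots<t_k$, the distribution of the Gaussian vector $(B_s^{(-m)}(t_1),\dots,B_s^{(-m)}(t_k))$ is non-degenerate, i.e. it is not carried by any proper affine subspace of $\mathbb R^k$ (equivalently, its covariance matrix is invertible). -/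

import Mathlib

open MeasureTheory ProbabilityTheory

/-- `B` is a (two-sided) fractional Brownian motion with exponent `s` (Hurst index `s / 2`) and
scale `C`: a centered Gaussian process indexed by `ℝ` with
`Cov (B u, B t) = C (|u| ^ s + |t| ^ s - |u - t| ^ s)`.
The process is taken in a (jointly) measurable version, so that its paths can be integrated. -/
structure IsFBM {Ω : Type*} [MeasurableSpace Ω] (P : Measure Ω) (s C : ℝ) (B : ℝ → Ω → ℝ) :
    Prop where
  isGaussianProcess : IsGaussianProcess B P
  aemeasurable_uncurry : AEMeasurable (Function.uncurry B) (volume.prod P)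
  centered : ∀ t, ∫ ω, B t ω ∂P = 0
  covariance_eq : ∀ u t, cov[B u, B t; P] = C * (|u| ^ s + |t| ^ s - |u - t| ^ s)

/-- The `m`-times integrated process `B^(-m)`, obtained by integrating paths from `0`. -/
noncomputable def iteratedIntegral {Ω : Type*} (B : ℝ → Ω → ℝ) : ℕ → ℝ → Ω → ℝ
  | 0 => B
  | m + 1 => fun u ω => ∫ t in (0 : ℝ)..u, iteratedIntegral B m t ω

/-- A law on `ℝ^k` is non-degenerate if it is not carried by a proper affine subspace. -/
def IsNondegenerateLaw {k : ℕ} (ν : Measure (Fin k → ℝ)) : Prop :=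
  ∀ A : AffineSubspace ℝ (Fin k → ℝ), A ≠ ⊤ → ¬ ∀ᵐ x ∂ν, x ∈ A

/-- The ND property of a process `Z` with domain of definition `T`: for all `k > 0` and all
`t₁ < ⋯ < t_k` in `T`, the joint law of `Z t₁, …, Z t_k` is non-degenerate. -/
def HasND {Ω T : Type*} [MeasurableSpace Ω] [Preorder T] (P : Measure Ω) (Z : T → Ω → ℝ) : Prop :=
  ∀ k : ℕ, 0 < k → ∀ t : Fin k → T, StrictMono t →
    IsNondegenerateLaw (P.map fun ω i => Z (t i) ω)

/-! Everything happens in L², where path integration commutes with inner products by Fubini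
(`integral_pathIntegral_mul`).

Gaussianity: if Y is orthogonal to every Z t, it is orthogonal to every path integral of Z. So each
iterated integral stays in the closed L² span of B (`iteratedIntegral_toLp_mem_closedSpan`), a space
of centered Gaussian variables.

Non-degeneracy: up to a positive factor, B has the same covariance as the deterministic
`spectralProcess` in L²(dx), a real substitute for the harmonic representation by exp(itx) - 1.
Iterated integration preserves this proportionality, so a null combination of the integrated B gives
a null combination of integrated spectral functions (`ae_sum_mul_eq_zero_of_covariance`). Rescaling
and differentiating m times yields ∑ aᵢ tᵢ^m f(tᵢ x) = 0 with f = sin + cos - 1. Further derivatives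
at 0 give ∑ aᵢ tᵢ^(m+n+1) = 0 for all n, and Vandermonde forces a = 0. -/

/-- A jointly measurable process whose second moments are finite and locally bounded in time. -/
structure IsLocallyL2Bounded {Ω : Type*} [MeasurableSpace Ω] (μ : Measure Ω) (Z : ℝ → Ω → ℝ) :
    Prop where
  aemeasurable_uncurry : AEMeasurable (Function.uncurry Z) (volume.prod μ)
  memLp : ∀ t, MemLp (Z t) 2 μ
  bound : ∀ T : ℝ, ∃ M : ℝ, ∀ t, |t| ≤ T → ∫ ω, Z t ω ^ 2 ∂μ ≤ M

/-- The process obtained by integrating paths from `0`. -/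
noncomputable def pathIntegral {Ω : Type*} (Z : ℝ → Ω → ℝ) : ℝ → Ω → ℝ :=
  fun u ω => ∫ t in (0 : ℝ)..u, Z t ω

lemma iteratedIntegral_succ {Ω : Type*} (Z : ℝ → Ω → ℝ) (m : ℕ) :
    iteratedIntegral Z (m + 1) = pathIntegral (iteratedIntegral Z m) := rfl

/-! ### Stability of local L² bounds under path integration. -/

namespace IsLocallyL2Bounded

variable {Ω : Type*} [MeasurableSpace Ω] {μ : Measure Ω} [SFinite μ] {Z : ℝ → Ω → ℝ}

lemma aestronglyMeasurable_restrict (hZ : IsLocallyL2Bounded μ Z) (s : Set ℝ) :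
    AEStronglyMeasurable (Function.uncurry Z) ((volume.restrict s).prod μ) := by
  refine (hZ.aemeasurable_uncurry.mono_ac ?_).aestronglyMeasurable
  exact Measure.AbsolutelyContinuous.prod Measure.restrict_le_self.absolutelyContinuous
    Measure.AbsolutelyContinuous.rfl

lemma abs_le_of_mem_uIoc {t u : ℝ} (ht : t ∈ Set.uIoc 0 u) : |t| ≤ |u| := by
  rcases Set.mem_uIoc.1 ht with h | h
  · rw [abs_of_pos h.1, abs_of_pos (h.1.trans_le h.2)]; exact h.2
  · rw [abs_of_nonpos h.2, abs_of_neg (h.1.trans_le h.2)]; linarith [h.1]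

lemma integrable_sq_uIoc (hZ : IsLocallyL2Bounded μ Z) (u : ℝ) :
    Integrable (fun p : ℝ × Ω => Z p.1 p.2 ^ 2) ((volume.restrict (Set.uIoc 0 u)).prod μ) := by
  have hm : AEStronglyMeasurable (fun p : ℝ × Ω => Z p.1 p.2 ^ 2)
      ((volume.restrict (Set.uIoc 0 u)).prod μ) :=
    (hZ.aestronglyMeasurable_restrict _).pow 2
  rw [integrable_prod_iff hm]
  refine ⟨.of_forall fun t => (hZ.memLp t).integrable_sq, ?_⟩
  obtain ⟨M, hM⟩ := hZ.bound |u|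
  refine IntegrableOn.of_bound ?_ hm.norm.integral_prod_right' M ?_
  · simp [Set.uIoc]
  · filter_upwards [ae_restrict_mem measurableSet_uIoc] with t ht
    have := hM t (abs_le_of_mem_uIoc ht)
    simp only [norm_pow, Real.norm_eq_abs, sq_abs, ge_iff_le]
    rwa [abs_of_nonneg (integral_nonneg fun _ => sq_nonneg _)]

lemma memLp_uIoc (hZ : IsLocallyL2Bounded μ Z) (u : ℝ) :
    MemLp (Function.uncurry Z) 2 ((volume.restrict (Set.uIoc 0 u)).prod μ) :=
  (memLp_two_iff_integrable_sq (hZ.aestronglyMeasurable_restrict _)).2 (hZ.integrable_sq_uIoc u)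

lemma integrable_mul_uIoc (hZ : IsLocallyL2Bounded μ Z) (u : ℝ) {Y : Ω → ℝ} (hY : MemLp Y 2 μ) :
    Integrable (fun p : ℝ × Ω => Z p.1 p.2 * Y p.2) ((volume.restrict (Set.uIoc 0 u)).prod μ) := by
  have : IsFiniteMeasure (volume.restrict (Set.uIoc 0 u)) := ⟨by simp [Set.uIoc]⟩
  exact (hZ.memLp_uIoc u).integrable_mul (hY.comp_snd _)

lemma ae_path_memLp (hZ : IsLocallyL2Bounded μ Z) (u : ℝ) :
    ∀ᵐ ω ∂μ, MemLp (fun t => Z t ω) 2 (volume.restrict (Set.uIoc 0 u)) := by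
  filter_upwards [(hZ.integrable_sq_uIoc u).prod_left_ae,
    (hZ.aestronglyMeasurable_restrict (Set.uIoc 0 u)).prodMk_right] with ω h1 h2
  exact (memLp_two_iff_integrable_sq h2).2 h1

lemma ae_intervalIntegrable (hZ : IsLocallyL2Bounded μ Z) :
    ∀ᵐ ω ∂μ, ∀ u : ℝ, IntervalIntegrable (fun t => Z t ω) volume 0 u := by
  have h (v : ℝ) : ∀ᵐ ω ∂μ, IntervalIntegrable (fun t => Z t ω) volume 0 v := by
    filter_upwards [hZ.ae_path_memLp v] with ω hω
    have : IsFiniteMeasure (volume.restrict (Set.uIoc 0 v)) := ⟨by simp [Set.uIoc]⟩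
    rw [intervalIntegrable_iff]
    exact hω.integrable one_le_two
  -- Integer endpoints suffice, so a single null set serves all u.
  have h' : ∀ᵐ ω ∂μ, ∀ n : ℤ, IntervalIntegrable (fun t => Z t ω) volume 0 n :=
    ae_all_iff.2 fun n => h n
  filter_upwards [h'] with ω hω u
  refine ((hω (-⌈|u|⌉)).symm.trans (hω ⌈|u|⌉)).mono_set ?_
  have hu := Int.le_ceil |u|
  have hu0 : (0 : ℝ) ≤ ⌈|u|⌉ := (abs_nonneg u).trans hu
  refine Set.uIcc_subset_uIcc (Set.mem_uIcc_of_le ?_ hu0) (Set.mem_uIcc_of_le ?_ ?_)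
  · push_cast; linarith
  · push_cast; linarith [neg_abs_le u]
  · linarith [le_abs_self u]

/-- Cauchy–Schwarz, read off from ∫ (|u| f - A)² ≥ 0 with A = ∫ f. -/
lemma sq_integral_le {f : ℝ → ℝ} {u : ℝ} (hf : MemLp f 2 (volume.restrict (Set.uIoc 0 u))) :
    (∫ t in (0 : ℝ)..u, f t) ^ 2 ≤ |u| * ∫ t in Set.uIoc 0 u, f t ^ 2 := by
  have hfin : IsFiniteMeasure (volume.restrict (Set.uIoc 0 u)) := ⟨by simp [Set.uIoc]⟩
  have h1 : (∫ t in (0 : ℝ)..u, f t) ^ 2 = (∫ t in Set.uIoc 0 u, f t) ^ 2 := by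
    rw [← sq_abs, intervalIntegral.abs_integral_eq_abs_integral_uIoc, sq_abs]
  have hv : (volume.restrict (Set.uIoc 0 u)).real Set.univ = |u| := by
    simp [Measure.real, Set.uIoc, Real.volume_Ioc, max_sub_min_eq_abs]
  have hfi := hf.integrable one_le_two
  have hf2 := hf.integrable_sq
  set A := ∫ t in Set.uIoc 0 u, f t with hA
  rcases eq_or_ne u 0 with rfl | hu
  · simp
  have h2 : 0 ≤ ∫ t in Set.uIoc 0 u, (|u| * f t - A) ^ 2 := integral_nonneg fun _ => sq_nonneg _
  have h3 : ∫ t in Set.uIoc 0 u, (|u| * f t - A) ^ 2 =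
      |u| ^ 2 * (∫ t in Set.uIoc 0 u, f t ^ 2) - 2 * |u| * A * A + |u| * A ^ 2 := by
    have : ∀ t, (|u| * f t - A) ^ 2 = (|u| ^ 2 * f t ^ 2 - 2 * |u| * A * f t) + A ^ 2 := by
      intro t; ring
    simp_rw [this]
    rw [integral_add (f := fun t => |u| ^ 2 * f t ^ 2 - 2 * |u| * A * f t)
        ((hf2.const_mul _).sub (hfi.const_mul _)) (integrable_const _),
      integral_sub (hf2.const_mul _) (hfi.const_mul _), integral_const_mul, integral_const_mul,
      integral_const, hv, smul_eq_mul, ← hA]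
  rw [h1]
  have hu' : 0 < |u| := abs_pos.2 hu
  rw [h3] at h2
  refine le_of_mul_le_mul_left ?_ hu'
  nlinarith [h2]

lemma pathIntegral_aestronglyMeasurable (hZ : IsLocallyL2Bounded μ Z) (u : ℝ) :
    AEStronglyMeasurable (pathIntegral Z u) μ := by
  have h (s : Set ℝ) : AEStronglyMeasurable (fun ω => ∫ t in s, Z t ω) μ :=
    (hZ.aestronglyMeasurable_restrict s).prod_swap.integral_prod_right'
  exact (h _).sub (h _)

/-- The integration domain varies with u; it is a section of a fixed measurable planar set, so an
indicator turns this into a parametric integral over all of ℝ. -/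
lemma pathIntegral_aemeasurable_uncurry (hZ : IsLocallyL2Bounded μ Z) :
    AEMeasurable (Function.uncurry (pathIntegral Z)) (volume.prod μ) := by
  have hq : Measure.QuasiMeasurePreserving (fun p : (ℝ × Ω) × ℝ => (p.2, p.1.2))
      (((volume : Measure ℝ).prod μ).prod volume) (volume.prod μ) := by
    have h1 : Measure.QuasiMeasurePreserving (Prod.map Prod.snd id)
        (((volume : Measure ℝ).prod μ).prod (volume : Measure ℝ)) (μ.prod volume) :=
      QuasiMeasurePreserving.prodMap Measure.quasiMeasurePreserving_snd
        (Measure.QuasiMeasurePreserving.id _)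
    exact (Measure.measurePreserving_swap (μ := μ)
      (ν := (volume : Measure ℝ))).quasiMeasurePreserving.comp h1
  have hZ' := hZ.aemeasurable_uncurry.comp_quasiMeasurePreserving hq
  have h (s : Set (ℝ × ℝ)) (hs : MeasurableSet s) :
      AEStronglyMeasurable (fun p : ℝ × Ω => ∫ t in {t | (p.1, t) ∈ s}, Z t p.2)
        (volume.prod μ) := by
    have hs' : MeasurableSet {p : (ℝ × Ω) × ℝ | (p.1.1, p.2) ∈ s} := by
      have : Measurable (fun p : (ℝ × Ω) × ℝ => (p.1.1, p.2)) := by fun_prop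
      exact this hs
    have := ((hZ'.indicator hs').aestronglyMeasurable).integral_prod_right'
    refine this.congr (.of_forall fun p => ?_)
    have hsp : MeasurableSet {t | (p.1, t) ∈ s} := by
      have : Measurable (fun t : ℝ => (p.1, t)) := by fun_prop
      exact this hs
    dsimp only
    rw [← integral_indicator hsp]
    rfl
  refine AEStronglyMeasurable.aemeasurable (f := Function.uncurry (pathIntegral Z)) ?_
  refine (h {q | q.2 ∈ Set.Ioc 0 q.1} ?_).sub (h {q | q.2 ∈ Set.Ioc q.1 0} ?_)
  · exact (measurableSet_lt measurable_const measurable_snd).inter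
      (measurableSet_le measurable_snd measurable_fst)
  · exact (measurableSet_lt measurable_fst measurable_snd).inter
      (measurableSet_le measurable_snd measurable_const)

protected lemma pathIntegral (hZ : IsLocallyL2Bounded μ Z) :
    IsLocallyL2Bounded μ (pathIntegral Z) := by
  have hle (u : ℝ) : ∀ᵐ ω ∂μ, pathIntegral Z u ω ^ 2 ≤ |u| * ∫ t in Set.uIoc 0 u, Z t ω ^ 2 := by
    filter_upwards [hZ.ae_path_memLp u] with ω hω using sq_integral_le hω
  have hint (u : ℝ) : Integrable (fun ω => |u| * ∫ t in Set.uIoc 0 u, Z t ω ^ 2) μ :=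
    (hZ.integrable_sq_uIoc u).integral_prod_right.const_mul _
  refine ⟨hZ.pathIntegral_aemeasurable_uncurry, fun u => ?_, fun T => ?_⟩
  · rw [memLp_two_iff_integrable_sq (hZ.pathIntegral_aestronglyMeasurable u)]
    refine (hint u).mono' ((hZ.pathIntegral_aestronglyMeasurable u).pow 2) ?_
    filter_upwards [hle u] with ω hω
    simpa using hω
  · obtain ⟨M, hM⟩ := hZ.bound T
    -- One factor T comes from Cauchy–Schwarz, the other from the length of the interval.
    refine ⟨T * (T * M), fun u hu => ?_⟩
    have hT : 0 ≤ T := (abs_nonneg u).trans hu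
    have hM0 : 0 ≤ M := (integral_nonneg fun _ => sq_nonneg _).trans (hM u hu)
    have h1 : ∫ ω, pathIntegral Z u ω ^ 2 ∂μ ≤ ∫ ω, |u| * (∫ t in Set.uIoc 0 u, Z t ω ^ 2) ∂μ :=
      integral_mono_of_nonneg (.of_forall fun _ => sq_nonneg _) (hint u) (hle u)
    refine h1.trans ?_
    rw [integral_const_mul]
    gcongr
    rw [← integral_integral_swap (f := fun t ω => Z t ω ^ 2) (hZ.integrable_sq_uIoc u)]
    have h2 : ∫ t in Set.uIoc 0 u, ∫ ω, Z t ω ^ 2 ∂μ ≤ ∫ t in Set.uIoc 0 u, M := by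
      refine integral_mono_of_nonneg (.of_forall fun _ => integral_nonneg fun _ => sq_nonneg _)
        (by simp [Set.uIoc]) ?_
      filter_upwards [ae_restrict_mem measurableSet_uIoc] with t ht
      exact hM t ((abs_le_of_mem_uIoc ht).trans hu)
    refine h2.trans ?_
    have hv : volume.real (Set.uIoc 0 u) = |u| := by
      simp [Measure.real, Set.uIoc, Real.volume_Ioc, max_sub_min_eq_abs]
    rw [setIntegral_const, hv, smul_eq_mul]
    gcongr

lemma integral_pathIntegral_mul (hZ : IsLocallyL2Bounded μ Z) {Y : Ω → ℝ} (hY : MemLp Y 2 μ)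
    (u : ℝ) :
    ∫ ω, pathIntegral Z u ω * Y ω ∂μ = ∫ t in (0 : ℝ)..u, ∫ ω, Z t ω * Y ω ∂μ := by
  rw [intervalIntegral_integral_swap]
  · simp [pathIntegral]
  · exact hZ.integrable_mul_uIoc u hY

protected lemma iteratedIntegral (hZ : IsLocallyL2Bounded μ Z) (m : ℕ) :
    IsLocallyL2Bounded μ (iteratedIntegral Z m) := by
  induction m with
  | zero => exact hZ
  | succ m ih => exact ih.pathIntegral

/-- Fubini once in each time variable. The measures need only be s-finite, since ν will be Lebesgue
measure. -/
lemma integral_iteratedIntegral_mul_eq {Ω' : Type*} [MeasurableSpace Ω'] {ν : Measure Ω'}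
    [SFinite ν] {W : ℝ → Ω' → ℝ} (hZ : IsLocallyL2Bounded μ Z) (hW : IsLocallyL2Bounded ν W)
    {c : ℝ} (h : ∀ u t, ∫ ω, Z u ω * Z t ω ∂μ = c * ∫ x, W u x * W t x ∂ν) (m : ℕ) :
    ∀ u t, ∫ ω, iteratedIntegral Z m u ω * iteratedIntegral Z m t ω ∂μ =
      c * ∫ x, iteratedIntegral W m u x * iteratedIntegral W m t x ∂ν := by
  induction m with
  | zero => exact h
  | succ m ih =>
    intro u t
    have hZm := hZ.iteratedIntegral m
    have hWm := hW.iteratedIntegral m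
    simp_rw [iteratedIntegral_succ]
    rw [hZm.integral_pathIntegral_mul (hZm.pathIntegral.memLp t),
      hWm.integral_pathIntegral_mul (hWm.pathIntegral.memLp t),
      ← intervalIntegral.integral_const_mul]
    congr 1 with r
    simp_rw [mul_comm (iteratedIntegral Z m r _), mul_comm (iteratedIntegral W m r _)]
    rw [hZm.integral_pathIntegral_mul (hZm.memLp r),
      hWm.integral_pathIntegral_mul (hWm.memLp r), ← intervalIntegral.integral_const_mul]
    congr 1 with q
    exact ih q r

end IsLocallyL2Bounded

/-! ### Gaussianity through the closed L² span. -/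

lemma coeFn_sum_smul_toLp {Ω ι : Type*} [MeasurableSpace Ω] {P : Measure Ω} {X : ι → Ω → ℝ}
    (s : Finset ι) (c : ι → ℝ) (hX : ∀ i, MemLp (X i) 2 P) :
    (∑ i ∈ s, c i • (hX i).toLp (X i) : Lp ℝ 2 P) =ᵐ[P] fun ω => ∑ i ∈ s, c i * X i ω := by
  classical
  induction s using Finset.induction_on with
  | empty => simpa using! Lp.coeFn_zero ℝ 2 P
  | insert i s hi ih =>
    rw [Finset.sum_insert hi]
    filter_upwards [Lp.coeFn_add (c i • (hX i).toLp (X i)) (∑ i ∈ s, c i • (hX i).toLp (X i)),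
      Lp.coeFn_smul (c i) ((hX i).toLp (X i)), (hX i).coeFn_toLp, ih] with ω h1 h2 h3 h4
    rw [h1, Pi.add_apply, h2, Pi.smul_apply, h3, h4, Finset.sum_insert hi, smul_eq_mul]

lemma charFun_map_Lp {Ω : Type*} [MeasurableSpace Ω] {P : Measure Ω} (X : Lp ℝ 2 P) (t : ℝ) :
    charFun (P.map X) t = ∫ ω, Complex.exp ((t * X ω : ℝ) * Complex.I) ∂P := by
  have hX : AEMeasurable X P := (Lp.aestronglyMeasurable X).aemeasurable
  rw [charFun_apply_real, integral_map hX (by fun_prop)]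
  push_cast
  rfl

section Gaussian

variable {Ω : Type*} [MeasurableSpace Ω] {P : Measure Ω} [IsProbabilityMeasure P]

lemma integral_norm_le_norm_Lp_two (X : Lp ℝ 2 P) : ∫ ω, ‖X ω‖ ∂P ≤ ‖X‖ := by
  rw [integral_norm_eq_lintegral_enorm (Lp.aestronglyMeasurable X), ← eLpNorm_one_eq_lintegral_enorm,
    Lp.norm_def]
  exact ENNReal.toReal_mono (Lp.eLpNorm_ne_top X)
    (eLpNorm_le_eLpNorm_of_exponent_le one_le_two (Lp.aestronglyMeasurable X))

lemma norm_cexp_mul_I_sub_le (a b : ℝ) :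
    ‖Complex.exp (a * Complex.I) - Complex.exp (b * Complex.I)‖ ≤ |a - b| := by
  have h : Complex.exp (a * Complex.I) - Complex.exp (b * Complex.I) =
      Complex.exp (b * Complex.I) * (Complex.exp (Complex.I * (a - b : ℝ)) - 1) := by
    rw [mul_sub, ← Complex.exp_add, mul_one]
    congr 2
    push_cast
    ring
  rw [h, norm_mul, Complex.norm_exp_ofReal_mul_I, one_mul]
  exact Real.norm_exp_I_mul_ofReal_sub_one_le

/-- Lipschitz with constant |t|, as exp(i·) is 1-Lipschitz and the L¹ norm is at most the L² norm.
-/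
lemma continuous_integral_cexp_mul_I (t : ℝ) :
    Continuous fun X : Lp ℝ 2 P => ∫ ω, Complex.exp ((t * X ω : ℝ) * Complex.I) ∂P := by
  have hint (X : Lp ℝ 2 P) :
      Integrable (fun ω => Complex.exp ((t * X ω : ℝ) * Complex.I)) P := by
    refine Integrable.of_bound ?_ 1 (.of_forall fun ω => (Complex.norm_exp_ofReal_mul_I _).le)
    have hX : AEMeasurable X P := (Lp.aestronglyMeasurable X).aemeasurable
    exact AEMeasurable.aestronglyMeasurable (by fun_prop)
  refine (LipschitzWith.of_dist_le' (K := |t|) fun X Y => ?_).continuous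
  rw [dist_eq_norm, dist_eq_norm, ← integral_sub (hint X) (hint Y)]
  have h1 : ∀ᵐ ω ∂P, ‖Complex.exp ((t * X ω : ℝ) * Complex.I) -
      Complex.exp ((t * Y ω : ℝ) * Complex.I)‖ ≤ |t| * ‖(X - Y : Lp ℝ 2 P) ω‖ := by
    filter_upwards [Lp.coeFn_sub X Y] with ω hω
    refine (norm_cexp_mul_I_sub_le _ _).trans ?_
    rw [hω, Pi.sub_apply, Real.norm_eq_abs, ← abs_mul, mul_sub]
  have h2 : Integrable (fun ω => |t| * ‖(X - Y : Lp ℝ 2 P) ω‖) P :=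
    (((Lp.memLp (X - Y)).integrable one_le_two).norm).const_mul _
  refine (norm_integral_le_of_norm_le h2 h1).trans ?_
  rw [integral_const_mul]
  exact mul_le_mul_of_nonneg_left (integral_norm_le_norm_Lp_two _) (abs_nonneg t)

/-- The closed linear span in `L²` of the random variables of a square integrable process. -/
noncomputable def closedSpan (B : ℝ → Ω → ℝ) (hB : ∀ t, MemLp (B t) 2 P) :
    Submodule ℝ (Lp ℝ 2 P) :=
  (Submodule.span ℝ (Set.range fun t => (hB t).toLp (B t))).topologicalClosure

lemma map_eq_gaussianReal_of_mem_span {B : ℝ → Ω → ℝ} (hG : IsGaussianProcess B P)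
    (h0 : ∀ t, ∫ ω, B t ω ∂P = 0) (hB : ∀ t, MemLp (B t) 2 P) {X : Lp ℝ 2 P}
    (hX : X ∈ Submodule.span ℝ (Set.range fun t => (hB t).toLp (B t))) :
    P.map X = gaussianReal 0 (‖X‖ ^ 2).toNNReal := by
  obtain ⟨c, rfl⟩ := Finsupp.mem_span_range_iff_exists_finsupp.1 hX
  set X := c.sum fun t a => a • (hB t).toLp (B t) with hXdef
  have hae : X =ᵐ[P] fun ω => ∑ t ∈ c.support, c t * B t ω :=
    coeFn_sum_smul_toLp c.support c hB
  have hg : HasGaussianLaw X P := ((hG.smul c).hasGaussianLaw_fun_sum).congr hae.symm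
  have hm : ∫ ω, X ω ∂P = 0 := by
    rw [integral_congr_ae hae, integral_finsetSum]
    · simp [integral_const_mul, h0]
    · intro t _
      exact ((hB t).integrable one_le_two).smul (c t)
  rw [hg.map_eq_gaussianReal, hm, variance_of_integral_eq_zero hg.aemeasurable hm]
  congr 2
  rw [← real_inner_self_eq_norm_sq, L2.inner_def]
  simp [sq]

/-- Having the characteristic function exp(-‖X‖²t²/2) is a closed condition on X, and it holds on
the span. -/
lemma map_eq_gaussianReal_of_mem_closedSpan {B : ℝ → Ω → ℝ} (hG : IsGaussianProcess B P)
    (h0 : ∀ t, ∫ ω, B t ω ∂P = 0) (hB : ∀ t, MemLp (B t) 2 P) {X : Lp ℝ 2 P}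
    (hX : X ∈ closedSpan B hB) :
    P.map X = gaussianReal 0 (‖X‖ ^ 2).toNNReal := by
  have hc (t : ℝ) : IsClosed {X : Lp ℝ 2 P | ∫ ω, Complex.exp ((t * X ω : ℝ) * Complex.I) ∂P =
      Complex.exp ((-(‖X‖ ^ 2 * t ^ 2 / 2) : ℝ))} :=
    isClosed_eq (continuous_integral_cexp_mul_I t) (by fun_prop)
  have hgauss (X : Lp ℝ 2 P) (t : ℝ) : charFun (gaussianReal 0 (‖X‖ ^ 2).toNNReal) t =
      Complex.exp ((-(‖X‖ ^ 2 * t ^ 2 / 2) : ℝ)) := by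
    rw [charFun_gaussianReal]
    congr 1
    have : (((‖X‖ ^ 2).toNNReal : ℝ) : ℂ) = ((‖X‖ ^ 2 : ℝ) : ℂ) := by
      rw [Real.coe_toNNReal _ (sq_nonneg _)]
    rw [this]
    push_cast
    ring
  have hXm : AEMeasurable X P := (Lp.aestronglyMeasurable X).aemeasurable
  have := Measure.isProbabilityMeasure_map hXm
  refine Measure.ext_of_charFun (funext fun t => ?_)
  rw [hgauss, charFun_map_Lp]
  refine closure_minimal (fun Y hY => ?_) (hc t) hX
  rw [Set.mem_ofPred_eq, ← charFun_map_Lp, ← hgauss,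
    map_eq_gaussianReal_of_mem_span hG h0 hB hY]

/-- Uses S = Sᗮᗮ, which avoids approximating the integral by Riemann sums. -/
lemma pathIntegral_toLp_mem {Z : ℝ → Ω → ℝ} (hZ : IsLocallyL2Bounded P Z)
    {S : Submodule ℝ (Lp ℝ 2 P)} (hS : IsClosed (S : Set (Lp ℝ 2 P)))
    (hZS : ∀ t, (hZ.memLp t).toLp (Z t) ∈ S) (u : ℝ) :
    (hZ.pathIntegral.memLp u).toLp (pathIntegral Z u) ∈ S := by
  have : CompleteSpace S := hS.completeSpace_coe
  rw [← S.orthogonal_orthogonal, Submodule.mem_orthogonal]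
  intro Y hY
  have key (t : ℝ) : inner ℝ Y ((hZ.memLp t).toLp (Z t)) = ∫ ω, Z t ω * Y ω ∂P := by
    rw [L2.inner_def]
    refine integral_congr_ae ?_
    filter_upwards [(hZ.memLp t).coeFn_toLp] with ω hω
    simp [hω]
  rw [L2.inner_def]
  trans ∫ ω, pathIntegral Z u ω * Y ω ∂P
  · refine integral_congr_ae ?_
    filter_upwards [(hZ.pathIntegral.memLp u).coeFn_toLp] with ω hω
    simp [hω]
  · rw [hZ.integral_pathIntegral_mul (Lp.memLp Y)]
    simp_rw [← key]
    have h0 (t : ℝ) : inner ℝ Y ((hZ.memLp t).toLp (Z t)) = 0 :=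
      Submodule.inner_left_of_mem_orthogonal (hZS t) hY
    simp [h0]

lemma iteratedIntegral_toLp_mem_closedSpan {B : ℝ → Ω → ℝ} (hB : IsLocallyL2Bounded P B)
    (m : ℕ) (u : ℝ) :
    ((hB.iteratedIntegral m).memLp u).toLp (iteratedIntegral B m u) ∈
      closedSpan B hB.memLp := by
  induction m generalizing u with
  | zero => exact subset_closure (Submodule.subset_span ⟨u, rfl⟩)
  | succ m ih =>
    exact pathIntegral_toLp_mem (hB.iteratedIntegral m) (Submodule.isClosed_topologicalClosure _)
      ih u

lemma isGaussianProcess_iteratedIntegral {B : ℝ → Ω → ℝ} (hB : IsLocallyL2Bounded P B)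
    (hG : IsGaussianProcess B P) (h0 : ∀ t, ∫ ω, B t ω ∂P = 0) (m : ℕ) :
    IsGaussianProcess (iteratedIntegral B m) P := by
  refine ⟨fun I => ⟨isGaussian_of_map_eq_gaussianReal fun L => ?_⟩⟩
  classical
  have hBm := (hB.iteratedIntegral m).memLp
  have hmeas : AEMeasurable (fun ω => I.restrict (iteratedIntegral B m · ω)) P :=
    aemeasurable_pi_lambda _ fun i => (hBm i).aestronglyMeasurable.aemeasurable
  rw [AEMeasurable.map_map_of_aemeasurable (by fun_prop) hmeas]
  let X : Lp ℝ 2 P := ∑ i : I, L (Pi.single i 1) • (hBm i).toLp (iteratedIntegral B m i)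
  have hX : X ∈ closedSpan B hB.memLp :=
    Submodule.sum_mem _ fun i _ =>
      Submodule.smul_mem _ _ (iteratedIntegral_toLp_mem_closedSpan hB m i)
  refine ⟨0, (‖X‖ ^ 2).toNNReal, ?_⟩
  rw [← map_eq_gaussianReal_of_mem_closedSpan hG h0 hB.memLp hX]
  refine Measure.map_congr ?_
  filter_upwards [coeFn_sum_smul_toLp Finset.univ (fun i : I => L (Pi.single i 1))
    fun i => hBm i] with ω hω
  rw [hω, Function.comp_apply]
  conv_lhs => rw [← ContinuousLinearMap.coe_coe, LinearMap.pi_apply_eq_sum_univ L.toLinearMap]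
  have h (i : I) : (fun j => if i = j then (1 : ℝ) else 0) = Pi.single i 1 := by
    ext j
    simp [Pi.single_apply, eq_comm]
  simp [mul_comm, h, Finset.restrict]

end Gaussian

/-! ### Spectral representation of the covariance. -/

section SpectralProcess

/-- The real spectral process `(sin (t x) + cos (t x) - 1) |x| ^ (-(1 + s) / 2)`, whose covariance
under Lebesgue measure is that of fractional Brownian motion up to a constant. -/
noncomputable def spectralProcess (s t x : ℝ) : ℝ :=
  (Real.sin (t * x) + Real.cos (t * x) - 1) * √(|x| ^ (-1 - s))

/-- Near 0 the integrand is O(x^(1-s)), which needs s < 2; at infinity it is O(x^(-1-s)), which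
needs s > 0. -/
lemma integrable_one_sub_cos_mul_rpow {s : ℝ} (hs0 : 0 < s) (hs2 : s < 2) :
    Integrable fun x : ℝ => (1 - Real.cos x) * |x| ^ (-1 - s) := by
  set g : ℝ → ℝ := fun x => (1 - Real.cos x) * |x| ^ (-1 - s) with hg
  have hgm : Measurable g := by fun_prop
  have h1 : IntegrableOn g (Set.Ioc 0 1) := by
    have hr : IntegrableOn (fun x : ℝ => x ^ (1 - s)) (Set.Ioc 0 1) :=
      (intervalIntegral.intervalIntegrable_rpow' (a := 0) (b := 1) (r := 1 - s) (by linarith)).1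
    refine Integrable.mono' hr hgm.aestronglyMeasurable ?_
    filter_upwards [ae_restrict_mem measurableSet_Ioc] with x hx
    have hc : 0 ≤ 1 - Real.cos x := by linarith [Real.cos_le_one x]
    have hp : (0 : ℝ) ≤ x ^ (-1 - s) := Real.rpow_nonneg hx.1.le _
    rw [hg, Real.norm_eq_abs]
    dsimp only
    rw [abs_of_pos hx.1, abs_of_nonneg (mul_nonneg hc hp)]
    have h2 : x ^ (1 - s) = x ^ (2 : ℕ) * x ^ (-1 - s) := by
      rw [← Real.rpow_natCast, ← Real.rpow_add hx.1]
      congr 1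
      push_cast
      ring
    rw [h2]
    refine mul_le_mul_of_nonneg_right ?_ hp
    nlinarith [Real.one_sub_sq_div_two_le_cos (x := x), sq_nonneg x]
  have h2 : IntegrableOn g (Set.Ioi 1) := by
    have hr : IntegrableOn (fun x : ℝ => 2 * x ^ (-1 - s)) (Set.Ioi 1) :=
      (integrableOn_Ioi_rpow_of_lt (by linarith) one_pos).const_mul 2
    refine Integrable.mono' hr hgm.aestronglyMeasurable ?_
    filter_upwards [ae_restrict_mem measurableSet_Ioi] with x hx
    have hx0 : (0 : ℝ) < x := one_pos.trans hx
    have hc : 0 ≤ 1 - Real.cos x := by linarith [Real.cos_le_one x]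
    have hp : (0 : ℝ) ≤ x ^ (-1 - s) := Real.rpow_nonneg hx0.le _
    rw [hg, Real.norm_eq_abs]
    dsimp only
    rw [abs_of_pos hx0, abs_of_nonneg (mul_nonneg hc hp)]
    refine mul_le_mul_of_nonneg_right ?_ hp
    linarith [Real.neg_one_le_cos x]
  have h3 : IntegrableOn g (Set.Ioi 0) := by
    rw [← Set.Ioc_union_Ioi_eq_Ioi zero_le_one]
    exact h1.union h2
  have h4 : Integrable ((Set.Ioi 0).indicator g) := (integrable_indicator_iff measurableSet_Ioi).2 h3
  refine (h4.add h4.comp_neg).congr (.of_forall fun x => ?_)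
  rcases lt_trichotomy x 0 with hx | rfl | hx
  · simp [Set.indicator, hx, hx.le, hg]
  · simp [hg]
  · simp [Set.indicator, hx, hx.le, hg]

lemma one_sub_cos_mul_rpow_scale (s : ℝ) {u : ℝ} (hu : u ≠ 0) (x : ℝ) :
    (1 - Real.cos (u * x)) * |x| ^ (-1 - s) =
      |u| ^ (1 + s) * ((1 - Real.cos (u * x)) * |u * x| ^ (-1 - s)) := by
  have h : |u| ^ (1 + s) * |u| ^ (-1 - s) = 1 := by
    rw [← Real.rpow_add (abs_pos.2 hu)]
    norm_num
  rw [abs_mul, Real.mul_rpow (abs_nonneg _) (abs_nonneg _)]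
  linear_combination -(1 - Real.cos (u * x)) * |x| ^ (-1 - s) * h

lemma integrable_one_sub_cos_mul {s : ℝ} (hs0 : 0 < s) (hs2 : s < 2) (u : ℝ) :
    Integrable fun x : ℝ => (1 - Real.cos (u * x)) * |x| ^ (-1 - s) := by
  rcases eq_or_ne u 0 with rfl | hu
  · simp
  · simp_rw [one_sub_cos_mul_rpow_scale s hu]
    exact ((integrable_comp_mul_left_iff _ hu).2
      (integrable_one_sub_cos_mul_rpow hs0 hs2)).const_mul _

lemma integral_one_sub_cos_mul {s : ℝ} (hs0 : 0 < s) (u : ℝ) :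
    ∫ x : ℝ, (1 - Real.cos (u * x)) * |x| ^ (-1 - s) =
      (∫ x : ℝ, (1 - Real.cos x) * |x| ^ (-1 - s)) * |u| ^ s := by
  rcases eq_or_ne u 0 with rfl | hu
  · simp [Real.zero_rpow hs0.ne']
  · simp_rw [one_sub_cos_mul_rpow_scale s hu]
    rw [integral_const_mul,
      Measure.integral_comp_mul_left (fun y => (1 - Real.cos y) * |y| ^ (-1 - s)) u,
      smul_eq_mul, abs_inv, Real.rpow_add (abs_pos.2 hu), Real.rpow_one]
    have : |u| ≠ 0 := abs_ne_zero.2 hu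
    field_simp

lemma integral_one_sub_cos_mul_rpow_pos {s : ℝ} (hs0 : 0 < s) (hs2 : s < 2) :
    0 < ∫ x : ℝ, (1 - Real.cos x) * |x| ^ (-1 - s) := by
  rw [integral_pos_iff_support_of_nonneg _ (integrable_one_sub_cos_mul_rpow hs0 hs2)]
  · refine lt_of_lt_of_le ?_ (measure_mono (s := Set.Ioo 0 1) fun x hx => ?_)
    · simp
    · have hc : Real.cos x < 1 := by
        have := Real.cos_lt_cos_of_nonneg_of_le_pi le_rfl
          (by linarith [hx.2, Real.pi_gt_three]) hx.1
        simpa using this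
      exact mul_ne_zero (by linarith) (Real.rpow_pos_of_pos (abs_pos.2 hx.1.ne') _).ne'
  · exact fun x => mul_nonneg (by linarith [Real.cos_le_one x])
      (Real.rpow_nonneg (abs_nonneg _) _)

lemma measurable_uncurry_spectralProcess (s : ℝ) :
    Measurable (Function.uncurry (spectralProcess s)) := by
  unfold spectralProcess Function.uncurry
  fun_prop

lemma measurable_spectralProcess (s t : ℝ) : Measurable (spectralProcess s t) :=
  (measurable_uncurry_spectralProcess s).of_uncurry_left

lemma spectralProcess_mul (s u t x : ℝ) :
    spectralProcess s u x * spectralProcess s t x =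
      (Real.sin (u * x) + Real.cos (u * x) - 1) * (Real.sin (t * x) + Real.cos (t * x) - 1) *
        |x| ^ (-1 - s) := by
  have h := Real.mul_self_sqrt (Real.rpow_nonneg (abs_nonneg x) (-1 - s))
  rw [spectralProcess, spectralProcess]
  linear_combination (Real.sin (u * x) + Real.cos (u * x) - 1) *
    (Real.sin (t * x) + Real.cos (t * x) - 1) * h

lemma memLp_spectralProcess {s : ℝ} (hs0 : 0 < s) (hs2 : s < 2) (t : ℝ) :
    MemLp (spectralProcess s t) 2 volume := by
  have hm := (measurable_spectralProcess s t).aestronglyMeasurable (μ := volume)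
  rw [memLp_two_iff_integrable_sq hm]
  -- The 4 comes from (sin + cos - 1)² + (sin - cos + 1)² = 4(1 - cos).
  refine ((integrable_one_sub_cos_mul hs0 hs2 t).const_mul 4).mono' (hm.pow 2)
    (.of_forall fun x => ?_)
  rw [Real.norm_eq_abs, abs_of_nonneg (sq_nonneg _), sq, spectralProcess_mul, ← mul_assoc]
  refine mul_le_mul_of_nonneg_right ?_ (Real.rpow_nonneg (abs_nonneg _) _)
  nlinarith [Real.sin_sq_add_cos_sq (t * x), sq_nonneg (Real.sin (t * x) - Real.cos (t * x) + 1)]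

/-- The product splits into an even part, a combination of terms (1 - cos(vx))|x|^(-1-s) with v = u,
t, u - t, and an odd part `O` of integral zero. Homogeneity evaluates the even part. -/
lemma integral_spectralProcess_mul {s : ℝ} (hs0 : 0 < s) (hs2 : s < 2) (u t : ℝ) :
    ∫ x, spectralProcess s u x * spectralProcess s t x =
      (∫ x : ℝ, (1 - Real.cos x) * |x| ^ (-1 - s)) * (|u| ^ s + |t| ^ s - |u - t| ^ s) := by
  set H : ℝ → ℝ → ℝ := fun v x => (1 - Real.cos (v * x)) * |x| ^ (-1 - s) with hH
  set O : ℝ → ℝ := fun x =>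
    (Real.sin ((u + t) * x) - Real.sin (u * x) - Real.sin (t * x)) * |x| ^ (-1 - s) with hO
  have hHi (v : ℝ) : Integrable (H v) := integrable_one_sub_cos_mul hs0 hs2 v
  have hdec (x : ℝ) : spectralProcess s u x * spectralProcess s t x =
      (H u x + H t x - H (u - t) x) + O x := by
    rw [spectralProcess_mul]
    simp only [hH, hO, add_mul u t, sub_mul u t, Real.cos_sub, Real.sin_add]
    ring
  have hUi : Integrable fun x => spectralProcess s u x * spectralProcess s t x :=
    (memLp_spectralProcess hs0 hs2 u).integrable_mul (memLp_spectralProcess hs0 hs2 t)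
  have hEi : Integrable fun x => H u x + H t x - H (u - t) x :=
    ((hHi u).add (hHi t)).sub (hHi (u - t))
  have hOi : Integrable O := by
    refine (hUi.sub hEi).congr (.of_forall fun x => ?_)
    simp [hdec x]
  have hO0 : ∫ x, O x = 0 := by
    have h := integral_neg_eq_self O volume
    have hneg (x : ℝ) : O (-x) = -O x := by
      simp only [hO, mul_neg, Real.sin_neg, abs_neg]
      ring
    simp_rw [hneg, integral_neg] at h
    linarith
  have hHv (v : ℝ) := integral_one_sub_cos_mul hs0 v
  simp_rw [hdec]
  rw [integral_add hEi hOi, hO0, integral_sub (f := fun x => H u x + H t x) ((hHi u).add (hHi t))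
    (hHi _), integral_add (hHi u) (hHi t), hHv, hHv, hHv]
  ring

lemma isLocallyL2Bounded_of_covariance {Ω : Type*} [MeasurableSpace Ω] {μ : Measure Ω}
    {Z : ℝ → Ω → ℝ} (hm : AEMeasurable (Function.uncurry Z) (volume.prod μ))
    (hZ : ∀ t, MemLp (Z t) 2 μ) {s c : ℝ} (hs0 : 0 < s) (hc : 0 ≤ c)
    (h : ∀ u t, ∫ ω, Z u ω * Z t ω ∂μ = c * (|u| ^ s + |t| ^ s - |u - t| ^ s)) :
    IsLocallyL2Bounded μ Z := by
  refine ⟨hm, hZ, fun T => ⟨c * (T ^ s + T ^ s), fun t ht => ?_⟩⟩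
  simp_rw [sq, h, sub_self, abs_zero, Real.zero_rpow hs0.ne', sub_zero]
  gcongr

lemma isLocallyL2Bounded_spectralProcess {s : ℝ} (hs0 : 0 < s) (hs2 : s < 2) :
    IsLocallyL2Bounded volume (spectralProcess s) :=
  isLocallyL2Bounded_of_covariance (measurable_uncurry_spectralProcess s).aemeasurable
    (memLp_spectralProcess hs0 hs2) hs0 (integral_one_sub_cos_mul_rpow_pos hs0 hs2).le
    (integral_spectralProcess_mul hs0 hs2)

end SpectralProcess

/-! ### Linear independence of the integrated spectral functions. -/

section TrigonometricSums

/-- Each substitution y = tx absorbs one factor x; what remains is a one-variable iterated integral.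
`Unit` is a dummy sample space. -/
lemma pow_mul_iteratedIntegral_scale (f w : ℝ → ℝ) (m : ℕ) (t x : ℝ) :
    x ^ m * iteratedIntegral (fun t x => f (t * x) * w x) m t x =
      iteratedIntegral (fun t (_ : Unit) => f t) m (t * x) () * w x := by
  induction m generalizing t with
  | zero => simp [iteratedIntegral]
  | succ m ih =>
    simp only [iteratedIntegral]
    rw [pow_succ', mul_assoc, ← intervalIntegral.integral_const_mul]
    simp_rw [ih]
    rw [intervalIntegral.integral_mul_const, ← mul_assoc,
      intervalIntegral.mul_integral_comp_mul_right
        (f := fun y => iteratedIntegral (fun t (_ : Unit) => f t) m y ()), zero_mul]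

lemma continuous_iteratedIntegral_unit {f : ℝ → ℝ} (hf : Continuous f) (m : ℕ) :
    Continuous fun y => iteratedIntegral (fun t (_ : Unit) => f t) m y () := by
  induction m with
  | zero => exact hf
  | succ m ih =>
    exact intervalIntegral.continuous_primitive (fun a b => ih.intervalIntegrable a b) 0

lemma sum_mul_pow_mul_eq_zero_of_iteratedIntegral {ι : Type*} [Fintype ι] {f : ℝ → ℝ}
    (hf : Continuous f) (t : ι → ℝ) (m : ℕ) (a : ι → ℝ)
    (h : ∀ x, ∑ i, a i * iteratedIntegral (fun t (_ : Unit) => f t) m (t i * x) () = 0) :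
    ∀ x, ∑ i, a i * t i ^ m * f (t i * x) = 0 := by
  induction m generalizing a with
  | zero => simpa [iteratedIntegral] using h
  | succ m ih =>
    intro x
    -- Differentiating in x removes one integral and moves a factor tᵢ into the coefficient.
    have h' := ih (fun i => a i * t i) fun x => ?_
    · rw [← h' x]
      exact Finset.sum_congr rfl fun i _ => by ring
    · have hc := continuous_iteratedIntegral_unit hf m
      have hd (i : ι) : HasDerivAt
          (fun x => a i * iteratedIntegral (fun t (_ : Unit) => f t) (m + 1) (t i * x) ())
          (a i * t i * iteratedIntegral (fun t (_ : Unit) => f t) m (t i * x) ()) x := by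
        have h1 := intervalIntegral.integral_hasDerivAt_right (hc.intervalIntegrable 0 (t i * x))
          (hc.stronglyMeasurableAtFilter _ _) hc.continuousAt
        have h2 : HasDerivAt (fun x => t i * x) (t i) x := by
          simpa using (hasDerivAt_id x).const_mul (t i)
        refine ((h1.comp x h2).const_mul (a i)).congr_deriv ?_
        ring
      have hs := HasDerivAt.fun_sum (u := Finset.univ) fun i _ => hd i
      simp_rw [h] at hs
      exact hs.unique (hasDerivAt_const x 0)

lemma sum_mul_pow_succ_eq_zero_of_trig {ι : Type*} [Fintype ι] (t c : ι → ℝ)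
    (h : ∀ x, ∑ i, c i * (Real.sin (t i * x) + Real.cos (t i * x) - 1) = 0) (n : ℕ) :
    ∑ i, c i * t i ^ (n + 1) = 0 := by
  have hlin (i : ι) (x : ℝ) : HasDerivAt (fun x => t i * x) (t i) x := by
    simpa using (hasDerivAt_id x).const_mul (t i)
  have key (n : ℕ) : ∀ x, ∑ i, c i * t i ^ (n + 1) *
      (Real.cos (t i * x) - Real.sin (t i * x)) = 0 := by
    induction n with
    | zero =>
      intro x
      have hs := HasDerivAt.fun_sum (u := Finset.univ) fun i _ =>
        ((((hlin i x).sin).add ((hlin i x).cos)).sub_const 1).const_mul (c i)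
      simp only [Pi.add_apply, h] at hs
      rw [← hs.unique (hasDerivAt_const x 0)]
      exact Finset.sum_congr rfl fun i _ => by ring
    | succ n ih =>
      intro x
      -- Differentiating at -x turns cos - sin back into itself up to sign and a factor tᵢ, so the
      -- induction keeps one form.
      have hs := HasDerivAt.fun_sum (u := Finset.univ) fun i _ =>
        (((hlin i (-x)).cos).sub ((hlin i (-x)).sin)).const_mul (c i * t i ^ (n + 1))
      simp only [Pi.sub_apply, ih] at hs
      have := hs.unique (hasDerivAt_const (-x) 0)
      rw [← neg_eq_zero, ← this, ← Finset.sum_neg_distrib]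
      refine Finset.sum_congr rfl fun i _ => ?_
      rw [mul_neg, Real.sin_neg, Real.cos_neg]
      ring
  simpa using key n 0

lemma eq_zero_of_sum_mul_pow_succ {k : ℕ} {t c : Fin k → ℝ} (ht : Function.Injective t)
    (h0 : ∀ i, t i ≠ 0) (l : ℕ) (h : ∀ n, ∑ i, c i * t i ^ l * t i ^ (n + 1) = 0) : c = 0 := by
  have := Matrix.eq_zero_of_forall_pow_sum_mul_pow_eq_zero ht
    (v := fun i => c i * t i ^ l * t i) fun n => by
      rw [← h n]
      exact Finset.sum_congr rfl fun i _ => by ring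
  funext i
  simpa [h0 i] using congrFun this i

lemma eq_zero_of_sum_iteratedIntegral_spectralProcess {s : ℝ} {m k : ℕ} {t a : Fin k → ℝ}
    (ht : Function.Injective t) (h0 : ∀ i, t i ≠ 0)
    (h : ∀ᵐ x : ℝ, ∑ i, a i * iteratedIntegral (spectralProcess s) m (t i) x = 0) : a = 0 := by
  set f : ℝ → ℝ := fun y => Real.sin y + Real.cos y - 1 with hf
  have hfc : Continuous f := by fun_prop
  have hcont : Continuous fun x =>
      ∑ i, a i * iteratedIntegral (fun t (_ : Unit) => f t) m (t i * x) () :=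
    continuous_finsetSum _ fun i _ => continuous_const.mul
      ((continuous_iteratedIntegral_unit hfc m).comp (continuous_const.mul continuous_id))
  have hae : (fun x => ∑ i, a i * iteratedIntegral (fun t (_ : Unit) => f t) m (t i * x) ())
      =ᵐ[volume] fun _ => (0 : ℝ) := by
    have hne : ∀ᵐ x : ℝ, x ≠ 0 := by simp [ae_iff]
    filter_upwards [h, hne] with x hx hx0
    have hw : √(|x| ^ (-1 - s)) ≠ 0 :=
      (Real.sqrt_pos.2 (Real.rpow_pos_of_pos (abs_pos.2 hx0) _)).ne'
    refine (mul_eq_zero.1 ?_).resolve_right hw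
    rw [Finset.sum_mul, ← mul_zero (x ^ m), ← hx, Finset.mul_sum]
    refine Finset.sum_congr rfl fun i _ => ?_
    rw [mul_assoc, ← pow_mul_iteratedIntegral_scale f (fun x => √(|x| ^ (-1 - s))) m (t i) x]
    change _ = x ^ m * (a i * iteratedIntegral (fun t x => f (t * x) * √(|x| ^ (-1 - s))) m _ x)
    ring
  have hall := (Continuous.ae_eq_iff_eq volume hcont continuous_const).1 hae
  have h1 := sum_mul_pow_mul_eq_zero_of_iteratedIntegral hfc t m a fun x => congrFun hall x
  exact eq_zero_of_sum_mul_pow_succ ht h0 m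
    (sum_mul_pow_succ_eq_zero_of_trig t (fun i => a i * t i ^ m) h1)

end TrigonometricSums

/-! ### Transfer of null combinations and non-degenerate laws. -/

section Nondegenerate

lemma integral_sq_sum_mul {Ω ι : Type*} [Fintype ι] [MeasurableSpace Ω] {μ : Measure Ω}
    {X : ι → Ω → ℝ} (hX : ∀ i, MemLp (X i) 2 μ) (a : ι → ℝ) :
    ∫ ω, (∑ i, a i * X i ω) ^ 2 ∂μ = ∑ i, ∑ j, a i * a j * ∫ ω, X i ω * X j ω ∂μ := by
  have hint (i j : ι) : Integrable (fun ω => a i * a j * (X i ω * X j ω)) μ :=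
    ((hX i).integrable_mul (hX j)).const_mul _
  have hexp (ω : Ω) : (∑ i, a i * X i ω) ^ 2 = ∑ i, ∑ j, a i * a j * (X i ω * X j ω) := by
    rw [sq, Finset.sum_mul_sum]
    exact Finset.sum_congr rfl fun i _ => Finset.sum_congr rfl fun j _ => by ring
  simp_rw [hexp]
  rw [integral_finsetSum _ fun i _ => integrable_finsetSum _ fun j _ => hint i j]
  refine Finset.sum_congr rfl fun i _ => ?_
  rw [integral_finsetSum _ fun j _ => hint i j]
  simp_rw [integral_const_mul]

/-- The second moment of a combination depends only on the matrix of inner products. -/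
lemma ae_sum_mul_eq_zero_of_covariance {Ω Ω' ι : Type*} [Fintype ι] [MeasurableSpace Ω]
    [MeasurableSpace Ω'] {μ : Measure Ω} {ν : Measure Ω'} {X : ι → Ω → ℝ} {Y : ι → Ω' → ℝ}
    (hX : ∀ i, MemLp (X i) 2 μ) (hY : ∀ i, MemLp (Y i) 2 ν) {c : ℝ} (hc : c ≠ 0)
    (h : ∀ i j, ∫ ω, X i ω * X j ω ∂μ = c * ∫ x, Y i x * Y j x ∂ν) {a : ι → ℝ}
    (ha : ∀ᵐ ω ∂μ, ∑ i, a i * X i ω = 0) : ∀ᵐ x ∂ν, ∑ i, a i * Y i x = 0 := by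
  have h1 : ∫ ω, (∑ i, a i * X i ω) ^ 2 ∂μ = 0 := by
    rw [integral_eq_zero_of_ae]
    filter_upwards [ha] with ω hω
    simp [hω]
  have h2 : ∫ ω, (∑ i, a i * X i ω) ^ 2 ∂μ = c * ∫ x, (∑ i, a i * Y i x) ^ 2 ∂ν := by
    rw [integral_sq_sum_mul hX, integral_sq_sum_mul hY, Finset.mul_sum]
    refine Finset.sum_congr rfl fun i _ => ?_
    rw [Finset.mul_sum]
    refine Finset.sum_congr rfl fun j _ => ?_
    rw [h]
    ring
  have h3 : ∫ x, (∑ i, a i * Y i x) ^ 2 ∂ν = 0 :=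
    (mul_eq_zero.1 (h2.symm.trans h1)).resolve_left hc
  have hL : MemLp (fun x => ∑ i, a i * Y i x) 2 ν :=
    memLp_finsetSum _ fun i _ => (hY i).const_mul (a i)
  rw [integral_eq_zero_iff_of_nonneg (fun _ => sq_nonneg _) hL.integrable_sq] at h3
  filter_upwards [h3] with x hx
  simpa using hx

lemma integral_iteratedIntegral_eq_zero {Ω : Type*} [MeasurableSpace Ω] {P : Measure Ω}
    [IsProbabilityMeasure P] {B : ℝ → Ω → ℝ} (hB : IsLocallyL2Bounded P B)
    (h0 : ∀ t, ∫ ω, B t ω ∂P = 0) (m : ℕ) (u : ℝ) : ∫ ω, iteratedIntegral B m u ω ∂P = 0 := by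
  induction m generalizing u with
  | zero => exact h0 u
  | succ m ih =>
    have := (hB.iteratedIntegral m).integral_pathIntegral_mul (memLp_const (1 : ℝ)) u
    simpa [ih, ← iteratedIntegral_succ] using this

/-- A nonzero linear functional is constant on a proper affine subspace; centering forces that
constant to be 0. -/
lemma isNondegenerateLaw_map {Ω : Type*} [MeasurableSpace Ω] {P : Measure Ω}
    [IsProbabilityMeasure P] {k : ℕ} {X : Fin k → Ω → ℝ} (hX : ∀ i, Integrable (X i) P)
    (h0 : ∀ i, ∫ ω, X i ω ∂P = 0)
    (h : ∀ a : Fin k → ℝ, (∀ᵐ ω ∂P, ∑ i, a i * X i ω = 0) → a = 0) :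
    IsNondegenerateLaw (P.map fun ω i => X i ω) := by
  intro A hA hae
  have hm : AEMeasurable (fun ω i => X i ω) P :=
    aemeasurable_pi_lambda _ fun i => (hX i).aestronglyMeasurable.aemeasurable
  have hae' : ∀ᵐ ω ∂P, (fun i => X i ω) ∈ A := ae_of_ae_map hm hae
  obtain ⟨ω₀, hp⟩ := hae'.exists
  set p : Fin k → ℝ := fun i => X i ω₀
  have hdir : A.direction < ⊤ := by
    refine lt_top_iff_ne_top.2 fun htop => hA ?_
    exact (AffineSubspace.direction_eq_top_iff_of_nonempty ⟨p, hp⟩).1 htop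
  obtain ⟨l, hl0, hl⟩ := Submodule.exists_le_ker_of_lt_top _ hdir
  have hlx (x : Fin k → ℝ) : l x = ∑ i, l (Pi.single i 1) * x i := by
    rw [LinearMap.pi_apply_eq_sum_univ l x]
    refine Finset.sum_congr rfl fun i _ => ?_
    rw [smul_eq_mul, mul_comm]
    congr 2
    ext j
    simp [Pi.single_apply, eq_comm]
  have hconst : ∀ᵐ ω ∂P, ∑ i, l (Pi.single i 1) * X i ω = l p := by
    filter_upwards [hae'] with ω hω
    have h1 := hl (AffineSubspace.vsub_mem_direction hω hp)
    rw [LinearMap.mem_ker, vsub_eq_sub, map_sub, sub_eq_zero] at h1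
    rw [← h1, hlx]
  have hlp : l p = 0 := by
    have h1 : ∫ ω, ∑ i, l (Pi.single i 1) * X i ω ∂P = l p := by
      rw [integral_congr_ae hconst]
      simp
    rw [← h1, integral_finsetSum _ fun i _ => (hX i).const_mul _]
    simp [integral_const_mul, h0]
  have ha := h (fun i => l (Pi.single i 1)) (by simpa [hlp] using hconst)
  refine hl0 (LinearMap.ext fun x => ?_)
  rw [hlx]
  exact Finset.sum_eq_zero fun i _ => by rw [congrFun ha i]; simp

end Nondegenerate

/-! ### Application to fractional Brownian motion. -/

namespace IsFBM

variable {Ω : Type*} [MeasurableSpace Ω] {P : Measure Ω} {s C : ℝ}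
  {B : ℝ → Ω → ℝ}

lemma memLp_two (hB : IsFBM P s C B) (t : ℝ) : MemLp (B t) 2 P :=
  (hB.isGaussianProcess.hasGaussianLaw_eval t).memLp_two

lemma integral_mul [IsProbabilityMeasure P] (hB : IsFBM P s C B) (u t : ℝ) :
    ∫ ω, B u ω * B t ω ∂P = C * (|u| ^ s + |t| ^ s - |u - t| ^ s) := by
  rw [← hB.covariance_eq, covariance_eq_sub (hB.memLp_two u) (hB.memLp_two t)]
  simp [hB.centered]

lemma isLocallyL2Bounded [IsProbabilityMeasure P] (hB : IsFBM P s C B) (hs0 : 0 < s) (hC : 0 < C) :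
    IsLocallyL2Bounded P B :=
  isLocallyL2Bounded_of_covariance hB.aemeasurable_uncurry hB.memLp_two hs0 hC.le hB.integral_mul

lemma hasND_iteratedIntegral [IsProbabilityMeasure P] (hB : IsFBM P s C B) (hs0 : 0 < s)
    (hs2 : s < 2) (hC : 0 < C) (m : ℕ) :
    HasND P (fun u : Set.Ioi (0 : ℝ) => iteratedIntegral B m u) := by
  intro k _ t ht
  have hBL := hB.isLocallyL2Bounded hs0 hC
  have hUL := isLocallyL2Bounded_spectralProcess hs0 hs2
  have hκ := integral_one_sub_cos_mul_rpow_pos hs0 hs2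
  have hcov := hBL.integral_iteratedIntegral_mul_eq hUL
    (c := C / ∫ x : ℝ, (1 - Real.cos x) * |x| ^ (-1 - s)) (fun u t => by
    rw [hB.integral_mul, integral_spectralProcess_mul hs0 hs2]
    rw [← mul_assoc, div_mul_cancel₀ _ hκ.ne']) m
  refine isNondegenerateLaw_map (X := fun i => iteratedIntegral B m (t i))
    (fun i => ((hBL.iteratedIntegral m).memLp _).integrable one_le_two)
    (fun i => integral_iteratedIntegral_eq_zero hBL hB.centered m _) fun a ha => ?_
  refine eq_zero_of_sum_iteratedIntegral_spectralProcess (s := s) (m := m)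
    (t := fun i => (t i : ℝ)) (Subtype.val_injective.comp ht.injective)
    (fun i => (t i).2.ne') ?_
  exact ae_sum_mul_eq_zero_of_covariance (fun i => (hBL.iteratedIntegral m).memLp (t i))
    (fun i => (hUL.iteratedIntegral m).memLp (t i)) (div_pos hC hκ).ne'
    (fun i j => hcov (t i) (t j)) ha

end IsFBM

theorem mainTheorem9 {Ω : Type*} [MeasurableSpace Ω] (P : Measure Ω) [IsProbabilityMeasure P]
    (s C : ℝ) (hs0 : 0 < s) (hs2 : s < 2) (hC : 0 < C)
    (B : ℝ → Ω → ℝ) (hB : IsFBM P s C B) (m : ℕ) :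
    (∀ᵐ ω ∂P, ∀ u : ℝ, 0 ≤ u →
      IntervalIntegrable (fun t => iteratedIntegral B m t ω) volume 0 u) ∧
    IsGaussianProcess (fun u : Set.Ici (0 : ℝ) => iteratedIntegral B m u) P ∧
    HasND P (fun u : Set.Ioi (0 : ℝ) => iteratedIntegral B m u) := by
  have hBL := hB.isLocallyL2Bounded hs0 hC
  refine ⟨?_, ?_, hB.hasND_iteratedIntegral hs0 hs2 hC m⟩
  · filter_upwards [(hBL.iteratedIntegral m).ae_intervalIntegrable] with ω hω u _ using hω u
  · exact (isGaussianProcess_iteratedIntegral hBL hB.isGaussianProcess hB.centered m).restrict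
      (Set.Ici 0)
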